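/- Fix disjoint countably infinite sets of attributes, constants and relation names; each relation name $R$ has a finite set $\mathrm{Att}(R)$ of attributes. Let $\mathbb{K}=(K,\oplus,0)$ be a commutative monoid that is positive ($a\oplus b=0$ implies $a=b=0$) and weakly absorptive ($a\oplus b=b$ for some non-zero $a,b\in K$), and write $a\le b$ if $a\oplus c=b$ for some $c\in K$. A $\mathbb{K}$-relation over a finite attribute set $X$ is a finitely supported function from the set of tuples $t\colon X\to\mathrm{Const}$ to $K$. A $\mathbb{K}$-database $\mathfrak D$ over a schema (a finite set of relation names) assigns to each relation name $R$ of the schema a $\mathbb{K}$-relation $R^{\mathfrak D}$ over $\mathrm{Att}(R)$. For pairwise distinct $A_1,\dots,A_n\in\mathrm{Att}(R)$ and $\vec a\in\mathrm{Const}^n$, let $R^{\mathfrak D}[A_1,\dots,A_n](\vec a)$ be the $\oplus$-sum of $R^{\mathfrak D}(t)$ over all tuples $t$ with $t(A_i)=a_i$ for all $i$; for $n=0$ it is the total weight $R^{\mathfrak D}[\emptyset]$. The database is balanced if $R^{\mathfrak D}[\emptyset]=S^{\mathfrak D}[\emptyset]$ for all $R,S$ in its schema. An inclusion dependency (IND)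 is an expression $R[A_1,\dots,A_n]\le S[B_1,\dots,B_n]$ with $n\ge 0$, with $A_1,\dots,A_n\in\mathrm{Att}(R)$ pairwise distinct and $B_1,\dots,B_n\in\mathrm{Att}(S)$ pairwise distinct. $\mathfrak D$ satisfies it if $R^{\mathfrak D}[A_1,\dots,A_n](\vec a)\le S^{\mathfrak D}[B_1,\dots,B_n](\vec a)$ for all $\vec a\in\mathrm{Const}^n$. For a finite set $\Sigma\cup\{\tau\}$ of INDs, $\Sigma$ entails $\tau$ over balanced $\mathbb{K}$-databases if every balanced $\mathbb{K}$-database whose schema contains all relation names occurring in $\Sigma\cup\{\tau\}$ and which satisfies all INDs in $\Sigma$ also satisfies $\tau$. Consider the following rules. - Reflexivity: $R[\vec A]\le R[\vec A]$. - Transitivity: from $R[\vec A]\le S[\vec B]$ and $S[\vec B]\le T[\vec C]$ infer $R[\vec A]\le T[\vec C]$. - Projection and permutation: from $R[A_1,\dots,A_n]\le S[B_1,\dots,B_n]$ infer $R[A_{i_1},\dots,A_{i_\ell}]\le S[B_{i_1},\dots,B_{i_\ell}]$ for distinct $i_1,\dots,i_\ell\in\{1,\dots,n\}$. - Balance: $S[\emptyset]\le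 R[\emptyset]$ for all relation names $R,S$. Then these rules are sound and complete for entailment over balanced $\mathbb{K}$-databases: for every finite set $\Sigma\cup\{\tau\}$ of INDs, $\tau$ is derivable from $\Sigma$ by these rules if and only if $\Sigma$ entails $\tau$ over balanced $\mathbb{K}$-databases. -/

import Mathlib

namespace KInd

/-- The natural (pre)order of a commutative monoid. -/
def NatLE {K : Type*} [AddCommMonoid K] (a b : K) : Prop := ∃ c, a + c = b

/-- Positivity: a sum vanishes only if both summands do. -/
def Positive (K : Type*) [AddCommMonoid K] : Prop :=
  ∀ a b : K, a + b = 0 → a = 0 ∧ b = 0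

/-- Weak absorptivity: some non-zero element absorbs some non-zero element. -/
def WeaklyAbsorptive (K : Type*) [AddCommMonoid K] : Prop :=
  ∃ a b : K, a ≠ 0 ∧ b ≠ 0 ∧ a + b = b

/-- Tuples over the finite attribute set `X`. -/
abbrev Tup {Att : Type*} (Const : Type*) (X : Finset Att) : Type _ := {x // x ∈ X} → Const

/-- `K`-relations over `X`: functions from tuples over `X` to `K` with finite support. -/
abbrev KRel {Att : Type*} (Const K : Type*) [AddCommMonoid K] (X : Finset Att) : Type _ :=
  Tup Const X →₀ K

/-- The projection of a tuple to a subset of its attributes. -/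
def Tup.proj {Att Const : Type*} {X Y : Finset Att} (h : Y ⊆ X) (t : Tup Const X) :
    Tup Const Y := fun y => t ⟨y.1, h y.2⟩

/-- The marginalisation of a `K`-relation over `X` to `Y ⊆ X`: the value at a tuple `t` is the
sum of the weights of all tuples projecting to `t`. -/
noncomputable def marg {Att Const K : Type*} [AddCommMonoid K] {X Y : Finset Att} (h : Y ⊆ X)
    (r : KRel Const K X) : KRel Const K Y :=
  r.mapDomain (Tup.proj h)

/-- The set of attributes listed in a sequence of pairwise distinct attributes of `X`. -/
def seqAttrs {Att : Type*} {X : Finset Att} {n : ℕ} (A : Fin n ↪ {x // x ∈ X}) : Finset Att :=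
  Finset.univ.map (A.trans (Function.Embedding.subtype _))

theorem seqAttrs_subset {Att : Type*} {X : Finset Att} {n : ℕ} (A : Fin n ↪ {x // x ∈ X}) :
    seqAttrs A ⊆ X := by
  intro x hx
  obtain ⟨i, -, rfl⟩ := Finset.mem_map.1 hx
  exact (A i).2

theorem exists_of_mem_seqAttrs {Att : Type*} {X : Finset Att} {n : ℕ}
    (A : Fin n ↪ {x // x ∈ X}) (y : {x // x ∈ seqAttrs A}) : ∃ i, (A i).1 = y.1 := by
  obtain ⟨i, -, h⟩ := Finset.mem_map.1 y.2
  exact ⟨i, h⟩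

/-- The tuple over `{A₁, …, Aₙ}` that maps `Aᵢ` to `aᵢ`. -/
noncomputable def seqTuple {Att Const : Type*} {X : Finset Att} {n : ℕ}
    (A : Fin n ↪ {x // x ∈ X}) (a : Fin n → Const) : Tup Const (seqAttrs A) :=
  fun y => a (exists_of_mem_seqAttrs A y).choose

/-- `r[A₁, …, Aₙ](a₁, …, aₙ)`. -/
noncomputable def margSeq {Att Const K : Type*} [AddCommMonoid K] {X : Finset Att}
    (r : KRel Const K X) {n : ℕ} (A : Fin n ↪ {x // x ∈ X}) (a : Fin n → Const) : K :=
  marg (seqAttrs_subset A) r (seqTuple A a)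

/-- `seqTuple A a` indeed maps each `Aᵢ` to `aᵢ`. -/
theorem seqTuple_apply {Att Const : Type*} {X : Finset Att} {n : ℕ}
    (A : Fin n ↪ {x // x ∈ X}) (a : Fin n → Const) (i : Fin n)
    (h : (A i).1 ∈ seqAttrs A) : seqTuple A a ⟨(A i).1, h⟩ = a i := by
  have h2 := (exists_of_mem_seqAttrs A ⟨(A i).1, h⟩).choose_spec
  exact congrArg a (A.injective (Subtype.ext h2))

/-- `margSeq` is a push-forward along `t ↦ (t(A₁), …, t(Aₙ))`. -/
theorem margSeq_eq {Att Const K : Type*} [AddCommMonoid K] {X : Finset Att}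
    (r : KRel Const K X) {n : ℕ} (A : Fin n ↪ {x // x ∈ X}) (a : Fin n → Const) :
    margSeq r A a = r.mapDomain (fun t i => t (A i)) a := by
  have hmem : ∀ i, (A i).1 ∈ seqAttrs A := fun i =>
    Finset.mem_map.2 ⟨i, Finset.mem_univ _, rfl⟩
  have hinj : Function.Injective
      (fun (s : Tup Const (seqAttrs A)) (i : Fin n) => s ⟨(A i).1, hmem i⟩) := by
    intro s s' hs
    funext y
    obtain ⟨y, hy⟩ := y
    obtain ⟨i, hi⟩ := exists_of_mem_seqAttrs A ⟨y, hy⟩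
    subst hi
    exact congrFun hs i
  have ha : (fun i : Fin n => seqTuple A a ⟨(A i).1, hmem i⟩) = a :=
    funext fun i => seqTuple_apply A a i (hmem i)
  have h1 := Finsupp.mapDomain_apply hinj (marg (seqAttrs_subset A) r) (seqTuple A a)
  rw [marg, ← Finsupp.mapDomain_comp] at h1
  rw [margSeq, marg, ← h1]
  exact (congrArg (r.mapDomain (fun t i => t (A i))) ha)

/-- An inclusion dependency `R[A₁, …, Aₙ] ≤ S[B₁, …, Bₙ]`, where `att R` is the attribute set of
the relation name `R`, and both attribute sequences are pairwise distinct. -/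
structure IND {Rel Att : Type*} (att : Rel → Finset Att) where
  ar : ℕ
  lhs : Rel
  rhs : Rel
  lseq : Fin ar ↪ {x // x ∈ att lhs}
  rseq : Fin ar ↪ {x // x ∈ att rhs}

/-- The `K`-databases over the schema `S`. -/
abbrev KDatabase {Rel Att : Type*} (att : Rel → Finset Att) (Const K : Type*) [AddCommMonoid K]
    (S : Finset Rel) : Type _ :=
  ∀ R : {R // R ∈ S}, KRel Const K (att R.1)

/-- Satisfaction of an inclusion dependency whose relation names belong to the schema. -/
def Satisfies {Rel Att Const K : Type*} [AddCommMonoid K] {att : Rel → Finset Att}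
    {S : Finset Rel} (D : KDatabase att Const K S) (σ : IND att) : Prop :=
  ∃ (hl : σ.lhs ∈ S) (hr : σ.rhs ∈ S), ∀ a : Fin σ.ar → Const,
    NatLE (margSeq (D ⟨σ.lhs, hl⟩) σ.lseq a) (margSeq (D ⟨σ.rhs, hr⟩) σ.rseq a)

/-- A `K`-database is balanced if all its `K`-relations have the same marginalisation to `∅`. -/
def Balanced {Rel Att Const K : Type*} [AddCommMonoid K] {att : Rel → Finset Att}
    {S : Finset Rel} (D : KDatabase att Const K S) : Prop :=
  ∀ R R' : {R // R ∈ S},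
    marg (Finset.empty_subset (att R.1)) (D R) = marg (Finset.empty_subset (att R'.1)) (D R')

/-- The relation names of `σ` belong to the schema `S`. -/
def IND.Over {Rel Att : Type*} {att : Rel → Finset Att} (σ : IND att) (S : Finset Rel) : Prop :=
  σ.lhs ∈ S ∧ σ.rhs ∈ S

/-- Entailment over balanced `K`-databases, whose schema may be any finite set of relation names
that contains those occurring in the dependencies. -/
def BalancedEntails {Rel Att : Type*} {att : Rel → Finset Att} (Const K : Type*)
    [AddCommMonoid K] (Γ : Finset (IND att)) (τ : IND att) : Prop :=
  ∀ S : Finset Rel, (∀ σ ∈ Γ, σ.Over S) → τ.Over S →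
    ∀ D : KDatabase att Const K S, Balanced D → (∀ σ ∈ Γ, Satisfies D σ) → Satisfies D τ

/-- Derivability from `Γ` by reflexivity, transitivity, projection and permutation, and the
balance axioms. -/
inductive DerivesBalance {Rel Att : Type*} {att : Rel → Finset Att} (Γ : Finset (IND att)) :
    IND att → Prop
  | hyp (σ : IND att) (h : σ ∈ Γ) : DerivesBalance Γ σ
  | refl (R : Rel) (n : ℕ) (A : Fin n ↪ {x // x ∈ att R}) : DerivesBalance Γ ⟨n, R, R, A, A⟩
  | trans (R S T : Rel) (n : ℕ) (A : Fin n ↪ {x // x ∈ att R}) (B : Fin n ↪ {x // x ∈ att S})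
      (C : Fin n ↪ {x // x ∈ att T}) (h₁ : DerivesBalance Γ ⟨n, R, S, A, B⟩)
      (h₂ : DerivesBalance Γ ⟨n, S, T, B, C⟩) : DerivesBalance Γ ⟨n, R, T, A, C⟩
  | proj (R S : Rel) (n l : ℕ) (A : Fin n ↪ {x // x ∈ att R}) (B : Fin n ↪ {x // x ∈ att S})
      (i : Fin l ↪ Fin n) (h : DerivesBalance Γ ⟨n, R, S, A, B⟩) :
      DerivesBalance Γ ⟨l, R, S, i.trans A, i.trans B⟩
  | balance (S R : Rel) :
      DerivesBalance Γ
        ⟨0, S, R, Function.Embedding.ofIsEmpty, Function.Embedding.ofIsEmpty⟩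

end KInd

/-!
The rules are sound because the natural preorder is compatible with sums of weights. An
intermediate relation name of a derivation may lie outside the schema of the database at hand, so
the induction on derivations takes place over databases that interpret every relation name; a
balanced database extends to such a one by a single tuple, of the common total weight, in each
missing relation (`extendDb`).

For completeness, let `τ = R[A₁, …, Aₙ] ≤ S[B₁, …, Bₙ]` be underivable; `n ≥ 1` by the balance
rule. Let `a + b = b` with `a ≠ 0`, and take distinct constants `z, c₁, …, cₙ`. The weights of the
countermodel `counterRel` are the sum of two parts.

* The multiples of `b`: for each `i`, all tuples with values in the `n`-element set
  `{z, c₁, …, cₙ} ∖ {cᵢ}` carry the same weight, scaled by a power of `n` that makes up for the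
  different numbers of attributes. The marginal of this part at a vector `v` is the same multiple
  of `b` for all relations and attribute sequences (`margSeq_baseRel`). It is a positive multiple
  if `v` lies in one of these `n` sets, and it is `0` otherwise.
* The multiples of `a`: for each derivable `R[A₁, …, Aₙ] ≤ T[C₁, …, Cₙ]`, the tuple of `T` that
  maps `Cᵢ` to `cᵢ` and the other attributes to `z` has weight `a`.

A positive multiple of `b` absorbs every multiple of `a`. Hence the second part affects the
marginal at `v` only if all of `c₁, …, cₙ` occur in `v`, and there the multiplicity of `a` is
`0` or `1`, according to the derivability of a single dependency. Thus all dependencies in `Γ` hold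
and the database is balanced, whereas at `(c₁, …, cₙ)` the left side of `τ` has weight `a` and the
right side has weight `0`; by positivity, `τ` fails.
-/

namespace KInd

/-! ### The natural preorder -/

protected theorem NatLE.rfl {K : Type*} [AddCommMonoid K] {a : K} : NatLE a a := ⟨0, add_zero a⟩

theorem NatLE.trans {K : Type*} [AddCommMonoid K] {a b c : K} (h₁ : NatLE a b)
    (h₂ : NatLE b c) : NatLE a c := by
  obtain ⟨x, rfl⟩ := h₁
  obtain ⟨y, rfl⟩ := h₂
  exact ⟨x + y, (add_assoc _ _ _).symm⟩

theorem NatLE.nsmul {K : Type*} [AddCommMonoid K] (a : K) {m n : ℕ} (h : m ≤ n) :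
    NatLE (m • a) (n • a) :=
  ⟨(n - m) • a, by rw [← add_nsmul, Nat.add_sub_cancel' h]⟩

theorem NatLE.mapDomain {α β K : Type*} [AddCommMonoid K] {f g : α →₀ K} (φ : α → β)
    (h : ∀ x, NatLE (f x) (g x)) (y : β) : NatLE (f.mapDomain φ y) (g.mapDomain φ y) := by
  classical
  choose d hd using h
  have hfg : f + Finsupp.onFinset (f.support ∪ g.support)
      (fun x => if x ∈ f.support ∪ g.support then d x else 0)
      (fun x hx => by by_contra h; exact hx (if_neg h)) = g := by
    ext x
    rw [Finsupp.add_apply, Finsupp.onFinset_apply]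
    split_ifs with hx
    · exact hd x
    · rw [Finset.notMem_union, Finsupp.notMem_support_iff, Finsupp.notMem_support_iff] at hx
      rw [hx.1, hx.2, add_zero]
  rw [← hfg, Finsupp.mapDomain_add, Finsupp.add_apply]
  exact ⟨_, Eq.refl _⟩

/-! ### Total weights and balance -/

theorem mapDomain_apply_of_subsingleton {α β K : Type*} [AddCommMonoid K] [Subsingleton β]
    (φ : α → β) (f : α →₀ K) (y : β) : f.mapDomain φ y = f.sum fun _ w => w := by
  classical
  rw [Finsupp.mapDomain, Finsupp.sum_apply]
  refine Finset.sum_congr rfl fun x _ => ?_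
  change Finsupp.single (φ x) (f x) y = f x
  rw [Subsingleton.elim (φ x) y, Finsupp.single_eq_same]

theorem balanced_iff {Rel Att Const K : Type*} [AddCommMonoid K] {att : Rel → Finset Att}
    {S : Finset Rel} (D : KDatabase att Const K S) :
    Balanced D ↔ ∀ R R', ((D R).sum fun _ w => w) = (D R').sum fun _ w => w := by
  have : IsEmpty {x : Att // x ∈ (∅ : Finset Att)} := ⟨fun x => Finset.notMem_empty _ x.2⟩
  refine forall₂_congr fun R R' => ⟨fun h => ?_, fun h => Finsupp.ext fun y => ?_⟩
  · have h0 := DFunLike.congr_fun h isEmptyElim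
    rwa [marg, marg, mapDomain_apply_of_subsingleton, mapDomain_apply_of_subsingleton] at h0
  · rw [marg, marg, mapDomain_apply_of_subsingleton, mapDomain_apply_of_subsingleton, h]

theorem margSeq_zero {Att Const K : Type*} [AddCommMonoid K] {X : Finset Att}
    (r : KRel Const K X) (A : Fin 0 ↪ {x // x ∈ X}) (a : Fin 0 → Const) :
    margSeq r A a = r.sum fun _ w => w := by
  rw [margSeq_eq, mapDomain_apply_of_subsingleton]

/-! ### Soundness -/

/-- Satisfaction of an inclusion dependency in a database that interprets all relation names. -/
def SatisfiesTotal {Rel Att Const K : Type*} [AddCommMonoid K] {att : Rel → Finset Att}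
    (D : ∀ R, KRel Const K (att R)) (σ : IND att) : Prop :=
  ∀ a : Fin σ.ar → Const, NatLE (margSeq (D σ.lhs) σ.lseq a) (margSeq (D σ.rhs) σ.rseq a)

theorem margSeq_trans {Att Const K : Type*} [AddCommMonoid K] {X : Finset Att}
    (r : KRel Const K X) {n l : ℕ} (A : Fin n ↪ {x // x ∈ X}) (i : Fin l ↪ Fin n)
    (a : Fin l → Const) :
    margSeq r (i.trans A) a =
      (r.mapDomain fun t j => t (A j)).mapDomain (fun (s : Fin n → Const) j => s (i j)) a := by
  rw [margSeq_eq, ← Finsupp.mapDomain_comp]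
  rfl

theorem DerivesBalance.satisfiesTotal {Rel Att Const K : Type*} [AddCommMonoid K]
    {att : Rel → Finset Att} {D : ∀ R, KRel Const K (att R)} {Γ : Finset (IND att)} {τ : IND att}
    (h : DerivesBalance Γ τ)
    (hbal : ∀ R R', ((D R).sum fun _ w => w) = (D R').sum fun _ w => w)
    (hΓ : ∀ σ ∈ Γ, SatisfiesTotal D σ) : SatisfiesTotal D τ := by
  induction h with
  | hyp σ h => exact hΓ σ h
  | refl R n A => exact fun _ => NatLE.rfl
  | trans R S T n A B C _ _ ih₁ ih₂ => exact fun a => (ih₁ a).trans (ih₂ a)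
  | proj R S n l A B i _ ih =>
    intro a
    simp only [margSeq_trans]
    refine NatLE.mapDomain _ (fun x => ?_) a
    have := ih x
    rwa [margSeq_eq, margSeq_eq] at this
  | balance S R =>
    intro a
    simp only [margSeq_zero, hbal S R]
    exact NatLE.rfl

open scoped Classical in
/-- The extension of a database to all relation names: every relation outside the schema consists
of a single constant tuple of weight `w`. -/
noncomputable def extendDb {Rel Att Const K : Type*} [AddCommMonoid K] {att : Rel → Finset Att}
    {S : Finset Rel} (D : KDatabase att Const K S) (z : Const) (w : K) (R : Rel) :
    KRel Const K (att R) :=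
  if h : R ∈ S then D ⟨R, h⟩ else Finsupp.single (fun _ => z) w

theorem extendDb_of_mem {Rel Att Const K : Type*} [AddCommMonoid K] {att : Rel → Finset Att}
    {S : Finset Rel} (D : KDatabase att Const K S) (z : Const) (w : K) {R : Rel} (h : R ∈ S) :
    extendDb D z w R = D ⟨R, h⟩ := dif_pos h

theorem DerivesBalance.balancedEntails {Rel Att Const K : Type*} [AddCommMonoid K] [Nonempty Const]
    {att : Rel → Finset Att} {Γ : Finset (IND att)} {τ : IND att} (h : DerivesBalance Γ τ) :
    BalancedEntails Const K Γ τ := by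
  intro S hS hτ D hD hΓ
  rw [balanced_iff] at hD
  obtain ⟨z⟩ := ‹Nonempty Const›
  set w : K := (D ⟨τ.lhs, hτ.1⟩).sum fun _ w => w with hw
  have hsum : ∀ R, ((extendDb D z w R).sum fun _ w => w) = w := by
    intro R
    by_cases hR : R ∈ S
    · rw [extendDb_of_mem D z w hR, hw]
      exact hD _ _
    · rw [extendDb, dif_neg hR, Finsupp.sum_single_index rfl]
  have hsat := h.satisfiesTotal (D := extendDb D z w) (fun R R' => by rw [hsum, hsum]) (by
    intro σ hσ a
    obtain ⟨hl, hr, h'⟩ := hΓ σ hσ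
    rw [extendDb_of_mem D z w hl, extendDb_of_mem D z w hr]
    exact h' a)
  refine ⟨hτ.1, hτ.2, fun a => ?_⟩
  have := hsat a
  rwa [extendDb_of_mem D z w hτ.1, extendDb_of_mem D z w hτ.2] at this

/-! ### Marginals of sums of weighted tuples -/

theorem margSeq_add {Att Const K : Type*} [AddCommMonoid K] {X : Finset Att}
    (r s : KRel Const K X) {n : ℕ} (A : Fin n ↪ {x // x ∈ X}) (v : Fin n → Const) :
    margSeq (r + s) A v = margSeq r A v + margSeq s A v := by
  simp only [margSeq_eq, Finsupp.mapDomain_add, Finsupp.add_apply]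

theorem margSeq_sum {Att Const K ι : Type*} [AddCommMonoid K] {X : Finset Att} (s : Finset ι)
    (r : ι → KRel Const K X) {n : ℕ} (A : Fin n ↪ {x // x ∈ X}) (v : Fin n → Const) :
    margSeq (∑ i ∈ s, r i) A v = ∑ i ∈ s, margSeq (r i) A v := by
  simp only [margSeq_eq, Finsupp.mapDomain_finsetSum, Finsupp.finsetSum_apply]

open scoped Classical in
theorem margSeq_sum_single {Att Const K ι : Type*} [AddCommMonoid K] {X : Finset Att}
    (s : Finset ι) (t : ι → Tup Const X) (w : K) {n : ℕ} (A : Fin n ↪ {x // x ∈ X})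
    (v : Fin n → Const) :
    margSeq (∑ i ∈ s, Finsupp.single (t i) w) A v =
      (s.filter fun i => ∀ j, t i (A j) = v j).card • w := by
  rw [margSeq_sum, ← Finset.sum_const, Finset.sum_filter]
  refine Finset.sum_congr rfl fun i _ => ?_
  rw [margSeq_eq, Finsupp.mapDomain_single, Finsupp.single_apply]
  simp only [funext_iff]

open scoped Classical in
theorem card_filter_piFinset_eq_on_range {ι C : Type*} [Fintype ι] [DecidableEq ι]
    (Y : Finset C) {k : ℕ} (A : Fin k ↪ ι) (v : Fin k → C) :
    ((Fintype.piFinset fun _ : ι => Y).filter fun t => ∀ j, t (A j) = v j).card =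
      if ∀ j, v j ∈ Y then Y.card ^ (Fintype.card ι - k) else 0 := by
  split_ifs with hv
  · have heq : ((Fintype.piFinset fun _ : ι => Y).filter fun t => ∀ j, t (A j) = v j) =
        Fintype.piFinset (Function.extend A (fun j => {v j}) fun _ => Y) := by
      ext t
      simp only [Finset.mem_filter, Fintype.mem_piFinset]
      constructor
      · rintro ⟨h₁, h₂⟩ x
        by_cases hx : ∃ j, A j = x
        · obtain ⟨j, rfl⟩ := hx
          rw [A.injective.extend_apply, Finset.mem_singleton]
          exact h₂ j
        · rw [Function.extend_apply' _ _ _ hx]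
          exact h₁ x
      · intro h
        have h₂ : ∀ j, t (A j) = v j := fun j => by
          have := h (A j)
          rwa [A.injective.extend_apply, Finset.mem_singleton] at this
        refine ⟨fun x => ?_, h₂⟩
        by_cases hx : ∃ j, A j = x
        · obtain ⟨j, rfl⟩ := hx
          rw [h₂]
          exact hv j
        · have := h x
          rwa [Function.extend_apply' _ _ _ hx] at this
    have hcard : (Finset.univ \ Finset.univ.map A).card = Fintype.card ι - k := by
      rw [Finset.card_sdiff_of_subset (Finset.subset_univ _), Finset.card_map, Finset.card_univ,
        Finset.card_univ, Fintype.card_fin]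
    rw [heq, Fintype.card_piFinset,
      ← Finset.prod_sdiff (Finset.subset_univ (Finset.univ.map A)), Finset.prod_map]
    simp only [A.injective.extend_apply, Finset.card_singleton, Finset.prod_const_one, mul_one]
    rw [← hcard]
    refine Finset.prod_eq_pow_card fun x hx => ?_
    have hx' : ¬∃ j, A j = x := fun ⟨j, hj⟩ =>
      (Finset.mem_sdiff.1 hx).2 (Finset.mem_map.2 ⟨j, Finset.mem_univ _, hj⟩)
    rw [Function.extend_apply' _ _ _ hx']
  · rw [Finset.card_eq_zero, Finset.filter_eq_empty_iff]
    exact fun t ht h => hv fun j => h j ▸ Fintype.mem_piFinset.1 ht _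

/-! ### The part of the countermodel common to all relations -/

open scoped Classical in
/-- The constants `z, c₁, …, cₙ` without `cᵢ`. -/
noncomputable def constsWithout {Const : Type*} {n : ℕ} (z : Const) (c : Fin n ↪ Const)
    (i : Fin n) : Finset Const :=
  (insert z (Finset.univ.map c)).erase (c i)

theorem card_constsWithout {Const : Type*} {n : ℕ} {z : Const} {c : Fin n ↪ Const}
    (hz : ∀ i, c i ≠ z) (i : Fin n) : (constsWithout z c i).card = n := by
  classical
  rw [constsWithout, Finset.card_erase_of_mem, Finset.card_insert_of_notMem, Finset.card_map,
    Finset.card_univ, Fintype.card_fin, Nat.add_sub_cancel]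
  · simpa using hz
  · simp

open scoped Classical in
/-- For each `i`, every tuple with values in `constsWithout z c i` is given the weight
`n ^ (m - |X|) • b`, where `m` is a bound on `|X|` that does not depend on the relation. -/
noncomputable def baseRel {Att Const K : Type*} [AddCommMonoid K] {n : ℕ} (z : Const)
    (c : Fin n ↪ Const) (b : K) (m : ℕ) (X : Finset Att) : KRel Const K X :=
  ∑ i, ∑ t ∈ Fintype.piFinset fun _ : {x // x ∈ X} => constsWithout z c i,
    Finsupp.single t (n ^ (m - X.card) • b)

open scoped Classical in
/-- The marginals of `baseRel` do not depend on the attributes. -/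
theorem margSeq_baseRel {Att Const K : Type*} [AddCommMonoid K] {n : ℕ} {z : Const}
    {c : Fin n ↪ Const} (hz : ∀ i, c i ≠ z) (b : K) {m : ℕ} {X : Finset Att} (hX : X.card ≤ m)
    {k : ℕ} (A : Fin k ↪ {x // x ∈ X}) (v : Fin k → Const) :
    margSeq (baseRel z c b m X) A v =
      ((Finset.univ.filter fun i => ∀ j, v j ∈ constsWithout z c i).card * n ^ (m - k)) • b := by
  have hk : k ≤ X.card := by
    simpa using Fintype.card_le_of_embedding A
  rw [baseRel, margSeq_sum, Finset.card_filter, Finset.sum_mul, ← Finset.sum_nsmul_assoc]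
  refine Finset.sum_congr rfl fun i _ => ?_
  rw [margSeq_sum_single, card_filter_piFinset_eq_on_range, card_constsWithout hz,
    Fintype.card_coe, smul_smul]
  split_ifs
  · rw [← pow_add, one_mul]
    congr 2
    omega
  · rw [zero_mul, zero_mul]

/-! ### The countermodel -/

open scoped Classical in
/-- Every tuple that maps `Cᵢ` to `cᵢ` and the other attributes to `z`, for some sequence `C` in
`F`, is given the weight `a`. -/
noncomputable def patternRel {Att Const K : Type*} [AddCommMonoid K] {n : ℕ} (z : Const)
    (c : Fin n ↪ Const) (a : K) {X : Finset Att} (F : (Fin n ↪ {x // x ∈ X}) → Prop) :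
    KRel Const K X :=
  ∑ C : Fin n ↪ {x // x ∈ X} with F C, Finsupp.single (Function.extend C c fun _ => z) a

open scoped Classical in
theorem margSeq_patternRel {Att Const K : Type*} [AddCommMonoid K] {n : ℕ} (z : Const)
    (c : Fin n ↪ Const) (a : K) {X : Finset Att} (F : (Fin n ↪ {x // x ∈ X}) → Prop)
    {k : ℕ} (A : Fin k ↪ {x // x ∈ X}) (v : Fin k → Const) :
    margSeq (patternRel z c a F) A v = (Finset.card {C : Fin n ↪ {x // x ∈ X} |
      F C ∧ ∀ j, Function.extend C c (fun _ => z) (A j) = v j}) • a := by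
  rw [patternRel, margSeq_sum_single, Finset.filter_filter]

theorem extend_eq_iff {ι Const : Type*} {n : ℕ} {z : Const} {c : Fin n ↪ Const}
    (hz : ∀ i, c i ≠ z) (C : Fin n ↪ ι) (x : ι) (i : Fin n) :
    Function.extend C c (fun _ => z) x = c i ↔ C i = x := by
  constructor
  · intro h
    by_cases hx : ∃ j, C j = x
    · obtain ⟨j, rfl⟩ := hx
      rw [C.injective.extend_apply] at h
      rw [c.injective h]
    · rw [Function.extend_apply' _ _ _ hx] at h
      exact absurd h.symm (hz i)
  · rintro rfl
    exact C.injective.extend_apply _ _ i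

/-- At a vector that contains all of `c₁, …, cₙ`, the marginals of `patternRel` take only the values
`0` and `a`, so that they are monotone along any dependency that carries sequences in `F` to
sequences in `G`. -/
theorem natLE_margSeq_patternRel {Att Const K : Type*} [AddCommMonoid K] {n : ℕ} {z : Const}
    {c : Fin n ↪ Const} (hz : ∀ i, c i ≠ z) (a : K) {X Y : Finset Att}
    {F : (Fin n ↪ {x // x ∈ X}) → Prop} {G : (Fin n ↪ {x // x ∈ Y}) → Prop} {k : ℕ}
    (A : Fin k ↪ {x // x ∈ X}) (B : Fin k ↪ {x // x ∈ Y})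
    (hFG : ∀ s : Fin n ↪ Fin k, F (s.trans A) → G (s.trans B)) {v : Fin k → Const}
    (hv : ∀ i, ∃ j, v j ∉ constsWithout z c i) :
    NatLE (margSeq (patternRel z c a F) A v) (margSeq (patternRel z c a G) B v) := by
  classical
  rw [margSeq_patternRel, margSeq_patternRel]
  apply NatLE.nsmul
  -- A vector matched by some pattern takes only the values `z, c₁, …, cₙ`, hence `hv` says that
  -- it takes all the values `c₁, …, cₙ`.
  have key : ∀ C : Fin n ↪ {x // x ∈ X},
      (∀ j, Function.extend C c (fun _ => z) (A j) = v j) → ∀ i, ∃ j, v j = c i := by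
    intro C hC i
    obtain ⟨j, hj⟩ := hv i
    refine ⟨j, ?_⟩
    by_contra hne
    refine hj ?_
    rw [constsWithout, Finset.mem_erase]
    refine ⟨hne, ?_⟩
    rw [← hC j]
    by_cases hx : ∃ l, C l = A j
    · obtain ⟨l, hl⟩ := hx
      rw [← hl, C.injective.extend_apply]
      simp
    · rw [Function.extend_apply' _ _ _ hx]
      exact Finset.mem_insert_self _ _
  rcases Finset.eq_empty_or_nonempty {C : Fin n ↪ {x // x ∈ X} |
      F C ∧ ∀ j, Function.extend C c (fun _ => z) (A j) = v j} with he | ⟨C, hC⟩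
  · rw [he, Finset.card_empty]
    exact Nat.zero_le _
  · rw [Finset.mem_filter] at hC
    obtain ⟨-, hF, hC⟩ := hC
    choose s hs using key C hC
    have hCs : ∀ C' : Fin n ↪ {x // x ∈ X},
        (∀ j, Function.extend C' c (fun _ => z) (A j) = v j) → ∀ i, C' i = A (s i) :=
      fun C' hC' i => (extend_eq_iff hz C' _ i).1 ((hC' (s i)).trans (hs i))
    have hsinj : Function.Injective s := fun i i' h => C.injective (by
      rw [hCs C hC, hCs C hC, h])
    have hCeq : C = Function.Embedding.trans ⟨s, hsinj⟩ A := by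
      ext1 i
      exact hCs C hC i
    refine le_trans (b := 1) ?_ ?_
    · rw [Finset.card_le_one]
      intro C₁ h₁ C₂ h₂
      rw [Finset.mem_filter] at h₁ h₂
      ext1 i
      rw [hCs C₁ h₁.2.2, hCs C₂ h₂.2.2]
    · rw [Nat.one_le_iff_ne_zero, ← Nat.pos_iff_ne_zero, Finset.card_pos]
      refine ⟨Function.Embedding.trans ⟨s, hsinj⟩ B, ?_⟩
      rw [Finset.mem_filter]
      refine ⟨Finset.mem_univ _, hFG _ (hCeq ▸ hF), fun j => ?_⟩
      rw [← hC j]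
      by_cases hj : ∃ i, s i = j
      · obtain ⟨i, rfl⟩ := hj
        rw [hC, hs]
        exact (extend_eq_iff hz _ _ i).2 rfl
      · rw [Function.extend_apply', Function.extend_apply']
        · rintro ⟨i, hi⟩
          exact hj ⟨i, A.injective ((hCs C hC i).symm.trans hi)⟩
        · rintro ⟨i, hi⟩
          exact hj ⟨i, B.injective hi⟩

theorem nsmul_add_nsmul_of_absorbs {K : Type*} [AddCommMonoid K] {a b : K} (hab : a + b = b)
    {N : ℕ} (hN : N ≠ 0) (M : ℕ) : N • b + M • a = N • b := by
  induction M with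
  | zero => rw [zero_nsmul, add_zero]
  | succ M ih =>
    obtain ⟨N, rfl⟩ := Nat.exists_eq_succ_of_ne_zero hN
    rw [succ_nsmul a, ← add_assoc, ih, succ_nsmul, add_assoc, add_comm b a, hab]

/-- The relation of the countermodel over the attribute set `X`, for the set `F` of those attribute
sequences that are derivably at least the left side of the dependency to be refuted. -/
noncomputable def counterRel {Att Const K : Type*} [AddCommMonoid K] {n : ℕ} (z : Const)
    (c : Fin n ↪ Const) (a b : K) (m : ℕ) (X : Finset Att) (F : (Fin n ↪ {x // x ∈ X}) → Prop) :
    KRel Const K X :=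
  baseRel z c b m X + patternRel z c a F

open scoped Classical in
/-- The pattern tuples are absorbed at the vectors that miss one of `c₁, …, cₙ`. -/
theorem margSeq_counterRel {Att Const K : Type*} [AddCommMonoid K] {n : ℕ} {z : Const}
    {c : Fin n ↪ Const} (hz : ∀ i, c i ≠ z) {a b : K} (hab : a + b = b) {m : ℕ} {X : Finset Att}
    (hX : X.card ≤ m) (F : (Fin n ↪ {x // x ∈ X}) → Prop) {k : ℕ} (A : Fin k ↪ {x // x ∈ X})
    {v : Fin k → Const} (hv : ∃ i, ∀ j, v j ∈ constsWithout z c i) :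
    margSeq (counterRel z c a b m X F) A v =
      ((Finset.univ.filter fun i => ∀ j, v j ∈ constsWithout z c i).card * n ^ (m - k)) • b := by
  obtain ⟨i, hi⟩ := hv
  rw [counterRel, margSeq_add, margSeq_baseRel hz b hX, margSeq_patternRel,
    nsmul_add_nsmul_of_absorbs hab]
  refine mul_ne_zero (Finset.card_ne_zero_of_mem (a := i) ?_) (pow_ne_zero _ i.pos.ne')
  exact Finset.mem_filter.2 ⟨Finset.mem_univ _, hi⟩

theorem margSeq_counterRel_of_forall {Att Const K : Type*} [AddCommMonoid K] {n : ℕ} {z : Const}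
    {c : Fin n ↪ Const} (hz : ∀ i, c i ≠ z) {a b : K} {m : ℕ} {X : Finset Att}
    (hX : X.card ≤ m) (F : (Fin n ↪ {x // x ∈ X}) → Prop) {k : ℕ} (A : Fin k ↪ {x // x ∈ X})
    {v : Fin k → Const} (hv : ∀ i, ∃ j, v j ∉ constsWithout z c i) :
    margSeq (counterRel z c a b m X F) A v = margSeq (patternRel z c a F) A v := by
  classical
  rw [counterRel, margSeq_add, margSeq_baseRel hz b hX, Finset.filter_eq_empty_iff.2,
    Finset.card_empty, zero_mul, zero_nsmul, zero_add]
  intro i _ h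
  obtain ⟨j, hj⟩ := hv i
  exact hj (h j)

theorem natLE_margSeq_counterRel {Att Const K : Type*} [AddCommMonoid K] {n : ℕ} {z : Const}
    {c : Fin n ↪ Const} (hz : ∀ i, c i ≠ z) {a b : K} (hab : a + b = b) {m : ℕ} {X Y : Finset Att}
    (hX : X.card ≤ m) (hY : Y.card ≤ m) {F : (Fin n ↪ {x // x ∈ X}) → Prop}
    {G : (Fin n ↪ {x // x ∈ Y}) → Prop} {k : ℕ}
    (A : Fin k ↪ {x // x ∈ X}) (B : Fin k ↪ {x // x ∈ Y})
    (hFG : ∀ s : Fin n ↪ Fin k, F (s.trans A) → G (s.trans B)) (v : Fin k → Const) :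
    NatLE (margSeq (counterRel z c a b m X F) A v) (margSeq (counterRel z c a b m Y G) B v) := by
  by_cases hv : ∃ i, ∀ j, v j ∈ constsWithout z c i
  · rw [margSeq_counterRel hz hab hX _ _ hv, margSeq_counterRel hz hab hY _ _ hv]
    exact NatLE.rfl
  · push Not at hv
    rw [margSeq_counterRel_of_forall hz hX _ _ hv, margSeq_counterRel_of_forall hz hY _ _ hv]
    exact natLE_margSeq_patternRel hz a A B hFG hv

/-- At `(c₁, …, cₙ)` the marginal on `A` has weight `a` or `0`, according to whether `A` belongs
to `F`. -/
theorem margSeq_counterRel_self {Att Const K : Type*} [AddCommMonoid K] {n : ℕ} {z : Const}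
    {c : Fin n ↪ Const} (hz : ∀ i, c i ≠ z) {a b : K} {m : ℕ} {X : Finset Att}
    (hX : X.card ≤ m) (F : (Fin n ↪ {x // x ∈ X}) → Prop)
    (A : Fin n ↪ {x // x ∈ X}) [Decidable (F A)] :
    margSeq (counterRel z c a b m X F) A c = if F A then a else 0 := by
  classical
  rw [margSeq_counterRel_of_forall hz hX _ _
    fun i => ⟨i, by simp [constsWithout]⟩, margSeq_patternRel]
  have hC : ∀ C : Fin n ↪ {x // x ∈ X},
      (∀ j, Function.extend C c (fun _ => z) (A j) = c j) ↔ C = A := by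
    intro C
    simp only [extend_eq_iff hz, DFunLike.ext_iff]
  simp only [hC]
  split_ifs with h
  · rw [Finset.card_eq_one.2 ⟨A, ?_⟩, one_nsmul]
    ext C
    simp only [Finset.mem_filter, Finset.mem_univ, true_and, Finset.mem_singleton]
    exact ⟨fun hC => hC.2, fun hC => ⟨hC ▸ h, hC⟩⟩
  · rw [Finset.card_eq_zero.2, zero_nsmul]
    rw [Finset.filter_eq_empty_iff]
    rintro C - ⟨hF, rfl⟩
    exact h hF

/-! ### Completeness -/

theorem derivesBalance_of_balancedEntails {Rel Att Const K : Type*} [Infinite Const]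
    {att : Rel → Finset Att} [AddCommMonoid K] (hpos : Positive K) (hwa : WeaklyAbsorptive K)
    {Γ : Finset (IND att)} {τ : IND att} (h : BalancedEntails Const K Γ τ) :
    DerivesBalance Γ τ := by
  classical
  obtain ⟨a, b, ha, -, hab⟩ := hwa
  obtain ⟨n, R, S, A, B⟩ := τ
  rcases Nat.eq_zero_or_pos n with rfl | hn
  · rw [Subsingleton.elim A Function.Embedding.ofIsEmpty,
      Subsingleton.elim B Function.Embedding.ofIsEmpty]
    exact DerivesBalance.balance R S
  by_contra hτ
  obtain ⟨e⟩ : Nonempty (Fin (n + 1) ↪ Const) :=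
    ⟨(Fin.valEmbedding).trans (Infinite.natEmbedding Const)⟩
  let z : Const := e 0
  let c : Fin n ↪ Const := (Fin.succEmb n).trans e
  have hz : ∀ i, c i ≠ z := fun i hi => Fin.succ_ne_zero i (e.injective hi)
  -- The schema consists of the relation names that occur in the dependencies.
  let sch : Finset Rel := insert R (insert S (Γ.image IND.lhs ∪ Γ.image IND.rhs))
  have hsch : ∀ σ ∈ Γ, σ.Over sch := fun σ hσ => by
    have hl := Finset.mem_image_of_mem IND.lhs hσ
    have hr := Finset.mem_image_of_mem IND.rhs hσ
    constructor <;> simp only [sch, Finset.mem_insert, Finset.mem_union, hl, hr, or_true, true_or]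
  have hRS : R ∈ sch ∧ S ∈ sch := by simp [sch]
  let m : ℕ := sch.sup fun T => (att T).card
  have hm : ∀ T ∈ sch, (att T).card ≤ m := fun T hT =>
    Finset.le_sup (f := fun T => (att T).card) hT
  let D : KDatabase att Const K sch := fun T =>
    counterRel z c a b m (att T.1) fun C => DerivesBalance Γ ⟨n, R, T.1, A, C⟩
  have hbal : Balanced D := by
    rw [balanced_iff]
    intro T T'
    -- The empty vector avoids every constant, so the total weight is a positive multiple of `b`
    -- that does not depend on the relation.
    have hv : ∃ i : Fin n, ∀ j : Fin 0, (isEmptyElim j : Const) ∈ constsWithout z c i :=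
      ⟨⟨0, hn⟩, isEmptyElim⟩
    rw [← margSeq_zero (D T) Function.Embedding.ofIsEmpty isEmptyElim,
      ← margSeq_zero (D T') Function.Embedding.ofIsEmpty isEmptyElim,
      margSeq_counterRel hz hab (hm _ T.2) _ _ hv, margSeq_counterRel hz hab (hm _ T'.2) _ _ hv]
  have hΓ : ∀ σ ∈ Γ, Satisfies D σ := fun σ hσ =>
    ⟨(hsch σ hσ).1, (hsch σ hσ).2, natLE_margSeq_counterRel hz hab (hm _ (hsch σ hσ).1)
      (hm _ (hsch σ hσ).2) _ _ fun s hs => .trans _ _ _ _ _ _ _ hs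
        (.proj _ _ _ _ _ _ s (.hyp σ hσ))⟩
  obtain ⟨_, _, hle⟩ := h sch hsch hRS D hbal hΓ
  obtain ⟨d, hd⟩ := hle c
  have hR : margSeq (D ⟨R, hRS.1⟩) A c = a :=
    (margSeq_counterRel_self hz (hm R hRS.1) _ A).trans (if_pos (.refl R n A))
  have hS : margSeq (D ⟨S, hRS.2⟩) B c = 0 :=
    (margSeq_counterRel_self hz (hm S hRS.2) _ B).trans (if_neg hτ)
  exact ha (hpos a d (by rw [← hR, ← hS]; exact hd)).1

end KInd

theorem mainTheorem8 {Rel Att Const K : Type*}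
    [Countable Rel] [Infinite Rel] [Countable Att] [Infinite Att]
    [Countable Const] [Infinite Const] (att : Rel → Finset Att)
    [AddCommMonoid K] (hpos : KInd.Positive K) (hwa : KInd.WeaklyAbsorptive K) :
    (∀ (Γ : Finset (KInd.IND att)) (τ : KInd.IND att),
      KInd.DerivesBalance Γ τ → KInd.BalancedEntails Const K Γ τ) ∧
    (∀ (Γ : Finset (KInd.IND att)) (τ : KInd.IND att),
      KInd.BalancedEntails Const K Γ τ → KInd.DerivesBalance Γ τ) :=
  ⟨fun _ _ h => h.balancedEntails,
    fun _ _ h => KInd.derivesBalance_of_balancedEntails hpos hwa h⟩
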